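/- Let $n\in\mathbb N$, $n\ge 2$, and let $\mathbb B_{n-1}(0,r)$ be the open ball of radius $r$ in $\mathbb R^{n-1}$. Let $S\subseteq\mathbb R^n$, $p\in S$, $R\in O_n(\mathbb R)$ and $r,\delta\in\,]0,+\infty[$. The set $C(p,R,r,\delta)=p+R^t(\mathbb B_{n-1}(0,r)\times]-\delta,\delta[)$ is called a coordinate cylinder for $S$ around $p$, and $\gamma$ the function that represents $S$ in it as a graph, if $\gamma:\mathbb B_{n-1}(0,r)\to\,]-\delta,\delta[$ is continuous, $\gamma(0)=0$, $|\gamma|<\delta/2$ on $\mathbb B_{n-1}(0,r)$, and $$R(S-p)\cap(\mathbb B_{n-1}(0,r)\times]-\delta,\delta[)=\{(\eta,\gamma(\eta)):\eta\in\mathbb B_{n-1}(0,r)\}.$$ Let $\|\gamma\|_{C^{0,1}}$ denote the sum of $\sup|\gamma|$ and of the Lipschitz constant of $\gamma$ on $\mathbb B_{n-1}(0,r)$ (equivalently, of its continuous extension on $\overline{\mathbb B_{n-1}(0,r)}$). $S$ is a local Lipschitz graph if around each $p\in S$ there is a coordinate cylinder for $S$ whose function $\gamma$ satisfies $\|\gamma\|_{C^{0,1}}<+\infty$.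 **Proposition.** Let $S$ be a compact local Lipschitz graph in $\mathbb R^n$, equipped with the ordinary $(n-1)$-dimensional (surface) measure $m_S$. Assume that there exist $r,\delta\in\,]0,+\infty[$ such that for each $x\in S$ there exists $R_x\in O_n(\mathbb R)$ such that $C(x,R_x,r,\delta)$ is a coordinate cylinder for $S$ around $x$ and the corresponding functions $\gamma_x$ satisfy $$\sup_{x\in S}\|\gamma_x\|_{C^{0,1}}<+\infty,\qquad \inf_{x\in S}\ \operatorname*{ess\,inf}_{\eta\in\mathbb B_{n-1}(0,r)\setminus\{0\}}\frac{(\eta+\gamma_x(\eta)D\gamma_x(\eta))\cdot\eta}{|\eta|^2}>0 .$$ Then $S$ is strongly upper $(n-1)$-Ahlfors regular with respect to $S$; that is, $m_S(S\cap B(x,\rho))<+\infty$ for all $x\in S$ and $\rho>0$, and there exist $r_0\in\,]0,+\infty]$ and $c\in\,]0,+\infty[$ such that $$m_S\bigl(S\cap(B(x,r_2)\setminus B(x,r_1))\bigr)\le c\,(r_2^{\,n-1}-r_1^{\,n-1})$$ for all $x\in S$ and all $0\le r_1<r_2<r_0$, where $B(x,\rho)$ is the open ball of radius $\rho$ in $\mathbb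 R^n$ and $B(x,0)=\emptyset$. -/

import Mathlib

open MeasureTheory Set Metric
open scoped ENNReal Gradient

noncomputable section

namespace LipschitzGraph

/-- The Euclidean space `ℝ^d`. -/
abbrev Euc (d : ℕ) : Type := EuclideanSpace ℝ (Fin d)

/-- The point `(η, y)` of `ℝ^{m+1} = ℝ^m × ℝ`. -/
def pt {m : ℕ} (η : Euc m) (y : ℝ) : Euc (m + 1) :=
  WithLp.toLp 2 (Fin.snoc (α := fun _ : Fin (m + 1) => ℝ) (fun i => η i) y)

/-- The set `𝔹_m(0, r) × ]-δ, δ[` as a subset of `ℝ^{m+1}`. -/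
def stdCylinder (m : ℕ) (r δ : ℝ) : Set (Euc (m + 1)) :=
  {z | ∃ η ∈ ball (0 : Euc m) r, ∃ y ∈ Ioo (-δ) δ, z = pt η y}

/-- The graph of `γ : 𝔹_m(0, r) → ℝ` as a subset of `ℝ^{m+1}`. -/
def graphOver {m : ℕ} (r : ℝ) (γ : Euc m → ℝ) : Set (Euc (m + 1)) :=
  {z | ∃ η ∈ ball (0 : Euc m) r, z = pt η (γ η)}

/-- `C(p, R, r, δ) = p + Rᵗ(𝔹_m(0, r) × ]-δ, δ[)` is a coordinate cylinder for `S` around `p ∈ S`,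
and `γ` is the function that represents `S` in it as a graph.  The orthogonal matrix `R ∈ O_{m+1}(ℝ)`
is given as a linear isometry of `ℝ^{m+1}` onto itself.  Only the values of `γ` in the open ball
`𝔹_m(0, r)` matter, and they are determined by the other data. -/
structure IsCoordCylinder {m : ℕ} (S : Set (Euc (m + 1))) (p : Euc (m + 1))
    (R : Euc (m + 1) ≃ₗᵢ[ℝ] Euc (m + 1)) (r δ : ℝ) (γ : Euc m → ℝ) : Prop where
  mem : p ∈ S
  r_pos : 0 < r
  δ_pos : 0 < δ
  continuousOn : ContinuousOn γ (ball 0 r)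
  mapsTo : MapsTo γ (ball 0 r) (Ioo (-δ) δ)
  inter_eq : (fun x => R (x - p)) '' S ∩ stdCylinder m r δ = graphOver r γ
  abs_lt : ∀ η ∈ ball (0 : Euc m) r, |γ η| < δ / 2
  map_zero : γ 0 = 0

/-- The norm of `γ` in `C^{0,1}` of the closed ball of radius `r`: the supremum of `|γ|` plus the
Lipschitz constant of `γ`, with value `∞` if `γ` is not bounded or not Lipschitz.  As usual, `γ` is
identified with its continuous extension to the closed ball, so that both terms may be computed in
the open ball. -/
def lipNorm {m : ℕ} (r : ℝ) (γ : Euc m → ℝ) : ℝ≥0∞ :=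
  (⨆ η ∈ ball (0 : Euc m) r, ENNReal.ofReal |γ η|) +
    ⨆ η ∈ ball (0 : Euc m) r, ⨆ ξ ∈ ball (0 : Euc m) r, ⨆ _ : η ≠ ξ,
      ENNReal.ofReal (|γ η - γ ξ| / ‖η - ξ‖)

/-- `S ⊆ ℝ^{m+1}` is a local Lipschitz graph (a local graph of class `C^{0,1}`). -/
def IsLocalLipschitzGraph {m : ℕ} (S : Set (Euc (m + 1))) : Prop :=
  ∀ p ∈ S, ∃ (R : Euc (m + 1) ≃ₗᵢ[ℝ] Euc (m + 1)) (r δ : ℝ) (γ : Euc m → ℝ),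
    IsCoordCylinder S p R r δ γ ∧ lipNorm r γ < ∞

/-- The quotient `(η + γ(η) Dγ(η)) · η / |η|²`. -/
def radialQuotient {m : ℕ} (γ : Euc m → ℝ) (η : Euc m) : ℝ :=
  inner ℝ (η + γ η • ∇ γ η) η / ‖η‖ ^ 2

/-- The essential infimum of `(η + γ(η) Dγ(η)) · η / |η|²` over `η ∈ 𝔹_m(0, r) \ {0}` with respect to
the Lebesgue measure, as an extended real number. -/
def radialEssInf {m : ℕ} (r : ℝ) (γ : Euc m → ℝ) : EReal :=
  essInf (fun η => (radialQuotient γ η : EReal)) (volume.restrict (ball (0 : Euc m) r \ {0}))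

/-- The ordinary `m`-dimensional (surface) measure on `S ⊆ ℝ^{m+1}`: the `m`-dimensional Hausdorff
measure, normalized so as to agree with the Lebesgue measure on `ℝ^m`. -/
def surfaceMeasure {m : ℕ} (S : Set (Euc (m + 1))) : Measure (Euc (m + 1)) :=
  μHE[m].restrict S

/-- `Y`, equipped with the measure `ν`, is strongly upper `υ`-Ahlfors regular with respect to `X`.
The first condition is the standing requirement that `ν` is finite on the sets `B(x, r) ∩ Y`.
The radius `r₀` may be infinite, and `ball x 0` is empty. -/
def IsStronglyUpperAhlforsRegular {M : Type*} [MetricSpace M] [MeasurableSpace M]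
    (X Y : Set M) (ν : Measure M) (υ : ℝ) : Prop :=
  (∀ x ∈ X, ∀ r : ℝ, 0 < r → ν (ball x r ∩ Y) < ∞) ∧
  ∃ r₀ : ℝ≥0∞, 0 < r₀ ∧ ∃ c : ℝ, 0 < c ∧
    ∀ x ∈ X, ∀ r₁ r₂ : ℝ, 0 ≤ r₁ → r₁ < r₂ → ENNReal.ofReal r₂ < r₀ →
      ν ((ball x r₂ \ ball x r₁) ∩ Y) ≤ ENNReal.ofReal (c * (r₂ ^ υ - r₁ ^ υ))

end LipschitzGraph

end

namespace LipschitzGraph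

open scoped NNReal

/-! Around each `x ∈ S` the radial condition, with a lower bound `a > 0`, says that `(1 - a)|η|² +
γ(η)²` has nonnegative radial derivative almost everywhere. It is therefore nondecreasing along rays
(`le_radial_of_ae`), so `|(η, γ(η))|²` grows at least as fast as `a|η|²`. Hence the map
`radialRescale`, which moves `η` along its ray to norm `|(η, γ(η))|`, has a Lipschitz inverse on its
image (`norm_sub_le_radialRescale`).

The graph map composed with that inverse is Lipschitz and preserves the distance to the centre. A
spherical shell of `S` is thus a Lipschitz image of a subset of the shell with the same radii in
`ℝ^m`, whose volume is a multiple of `r₂ ^ m - r₁ ^ m`. All constants depend only on `a`, on the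
bound `L` for the norms and on `m`, so they are uniform in `x`. -/

theorem le_of_ae_deriv_nonneg {f : ℝ → ℝ} {a b : ℝ} (hab : a ≤ b)
    (hf : AbsolutelyContinuousOnInterval f a b)
    (hd : ∀ᵐ t, t ∈ Ioc a b → 0 ≤ deriv f t) : f a ≤ f b := by
  rw [← sub_nonneg, ← hf.integral_deriv_eq_sub, intervalIntegral.integral_of_le hab]
  exact integral_nonneg_of_ae ((ae_restrict_iff' measurableSet_Ioc).2 hd)

/-! ### Monotonicity along rays. -/

section Rays

variable {E : Type*} [NormedAddCommGroup E] [InnerProductSpace ℝ E] [FiniteDimensional ℝ E]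
  [MeasurableSpace E] [BorelSpace E]

/-- An almost everywhere true property holds almost everywhere on almost every ray. -/
theorem ae_ae_smul {P : E → Prop} (hP : ∀ᵐ η : E, P η) : ∀ᵐ η : E, ∀ᵐ t : ℝ, P (t • η) := by
  -- A measurable null hull of the exceptional set, so that Fubini can exchange the two quantifiers.
  set N : Set E := toMeasurable volume {η | ¬ P η} with hN
  have hN0 : volume N = 0 := by rw [hN, measure_toMeasurable]; exact hP
  have hm : MeasurableSet {z : E × ℝ | z.2 • z.1 ∉ N} := by
    have hf : Measurable fun z : E × ℝ => z.2 • z.1 := by fun_prop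
    exact hf (measurableSet_toMeasurable _ _).compl
  have key : ∀ᵐ t : ℝ, ∀ᵐ η : E, t • η ∉ N := by
    have h0 : ∀ᵐ t : ℝ, t ≠ 0 := by simp [ae_iff]
    filter_upwards [h0] with t ht
    exact (Measure.quasiMeasurePreserving_smul (μ := (volume : Measure E)) ht).ae
      (p := fun x => x ∉ N) (by simpa [ae_iff] using hN0)
  have key' := (Measure.ae_ae_comm (μ := (volume : Measure E)) (ν := (volume : Measure ℝ))
    (p := fun η t => t • η ∉ N) hm).2 key
  filter_upwards [key'] with η hη
  filter_upwards [hη] with t ht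
  by_contra h
  exact ht (subset_toMeasurable _ _ h)

variable {γ : E → ℝ} {r a : ℝ} {L : ℝ≥0}

omit [FiniteDimensional ℝ E] [MeasurableSpace E] [BorelSpace E] in
theorem smul_mem_ball_of_mem_Icc {η : E} {s t : ℝ} (ht : s • η ∈ ball (0 : E) r)
    (h0 : 0 ≤ t) (hts : t ≤ s) : t • η ∈ ball (0 : E) r := by
  rw [mem_ball_zero_iff, norm_smul] at *
  refine lt_of_le_of_lt ?_ ht
  gcongr
  rw [Real.norm_of_nonneg h0, Real.norm_of_nonneg (h0.trans hts)]
  exact hts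

omit [FiniteDimensional ℝ E] [MeasurableSpace E] [BorelSpace E] in
theorem absolutelyContinuousOnInterval_comp_smul (hL : LipschitzOnWith L γ (ball 0 r)) {η : E}
    {s : ℝ} (hs : 1 ≤ s) (hη : s • η ∈ ball (0 : E) r) :
    AbsolutelyContinuousOnInterval (fun t : ℝ => γ (t • η)) 1 s := by
  have h1 : LipschitzOnWith ‖η‖₊ (fun t : ℝ => t • η) (uIcc 1 s) := by
    refine LipschitzOnWith.of_dist_le_mul fun x _ y _ => ?_
    rw [dist_eq_norm, ← sub_smul, norm_smul, mul_comm, dist_eq_norm]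
    rfl
  have h2 : MapsTo (fun t : ℝ => t • η) (uIcc 1 s) (ball 0 r) := fun t ht => by
    rw [uIcc_of_le hs] at ht
    exact smul_mem_ball_of_mem_Icc hη (by linarith [ht.1]) ht.2
  exact (hL.comp h1 h2).absolutelyContinuousOnInterval

omit [MeasurableSpace E] [BorelSpace E] in
-- The derivative equals `2 / t` times the difference of the two sides of `ha`.
theorem deriv_radial_nonneg {η : E} {t : ℝ} (ht : 0 < t) (hd : DifferentiableAt ℝ γ (t • η))
    (ha : a * ‖t • η‖ ^ 2 ≤ inner ℝ (t • η + γ (t • η) • ∇ γ (t • η)) (t • η)) :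
    0 ≤ deriv (fun s : ℝ => (1 - a) * ‖η‖ ^ 2 * (s * s) + γ (s • η) * γ (s • η)) t := by
  have h1 : HasDerivAt (fun s : ℝ => γ (s • η)) (inner ℝ (∇ γ (t • η)) η) t := by
    have h2 : HasDerivAt (fun s : ℝ => s • η) η t := by
      simpa using (hasDerivAt_id t).smul_const η
    exact hd.hasGradientAt.hasFDerivAt.comp_hasDerivAt t h2
  have h3 := (((hasDerivAt_id t).mul (hasDerivAt_id t)).const_mul ((1 - a) * ‖η‖ ^ 2)).add
    (h1.mul h1)
  have h4 : deriv (fun s : ℝ => (1 - a) * ‖η‖ ^ 2 * (s * s) + γ (s • η) * γ (s • η)) t = _ :=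
    h3.deriv
  rw [h4]
  rw [inner_add_left, inner_smul_left, inner_smul_right, inner_smul_left, inner_smul_right,
    real_inner_self_eq_norm_sq, norm_smul, Real.norm_of_nonneg ht.le] at ha
  simp only [RCLike.conj_to_real, id] at *
  have : 0 ≤ t * ((1 - a) * ‖η‖ ^ 2 * t + γ (t • η) * inner ℝ (∇ γ (t • η)) η) := by linarith
  have := nonneg_of_mul_nonneg_right this ht
  linarith

theorem le_radial_of_ae (hL : LipschitzOnWith L γ (ball 0 r))
    (ha : ∀ᵐ η : E, η ∈ ball (0 : E) r →
      a * ‖η‖ ^ 2 ≤ inner ℝ (η + γ η • ∇ γ η) η) {s : ℝ} (hs : 1 ≤ s) :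
    ∀ η : E, s • η ∈ ball (0 : E) r →
      (1 - a) * ‖η‖ ^ 2 + γ η ^ 2 ≤ (1 - a) * ‖s • η‖ ^ 2 + γ (s • η) ^ 2 := by
  have hd : ∀ᵐ η : E, η ∈ ball (0 : E) r → DifferentiableAt ℝ γ η := by
    filter_upwards [hL.ae_differentiableWithinAt_of_mem] with η h hη
    exact (h hη).differentiableAt (isOpen_ball.mem_nhds hη)
  have hae : ∀ᵐ η : E, s • η ∈ ball (0 : E) r →
      (1 - a) * ‖η‖ ^ 2 + γ η ^ 2 ≤ (1 - a) * ‖s • η‖ ^ 2 + γ (s • η) ^ 2 := by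
    filter_upwards [ae_ae_smul (ha.and hd)] with η hη hsη
    have hac := absolutelyContinuousOnInterval_comp_smul hL hs hsη
    have hid : AbsolutelyContinuousOnInterval (fun t : ℝ => t) 1 s :=
      (LipschitzWith.id.lipschitzOnWith (s := uIcc 1 s)).absolutelyContinuousOnInterval
    have hsum : AbsolutelyContinuousOnInterval
        (fun t : ℝ => (1 - a) * ‖η‖ ^ 2 * (t * t) + γ (t • η) * γ (t • η)) 1 s :=
      AbsolutelyContinuousOnInterval.add
        (AbsolutelyContinuousOnInterval.const_mul _ (hid.mul hid)) (hac.mul hac)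
    have := le_of_ae_deriv_nonneg hs hsum (by
        filter_upwards [hη] with t ht hts
        have h0 : 0 < t := by linarith [hts.1]
        have hb := smul_mem_ball_of_mem_Icc hsη h0.le hts.2
        exact deriv_radial_nonneg h0 (ht.2 hb) (ht.1 hb))
    rw [norm_smul, Real.norm_of_nonneg (by linarith)]
    simp only [one_smul] at this
    linarith
  intro η hη
  set U : Set E := (fun η : E => s • η) ⁻¹' ball 0 r
  have hU : IsOpen U := isOpen_ball.preimage (by fun_prop)
  have hcγ : ContinuousOn γ (ball 0 r) := hL.continuousOn
  have hsub : U ⊆ ball 0 r := fun ξ hξ => by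
    simpa using smul_mem_ball_of_mem_Icc (t := 1) hξ zero_le_one hs
  have hc1 : ContinuousOn (fun η : E => (1 - a) * ‖η‖ ^ 2 + γ η ^ 2) U :=
    (by fun_prop : Continuous fun η : E => (1 - a) * ‖η‖ ^ 2).continuousOn.add
      ((hcγ.mono hsub).pow 2)
  have hc2 : ContinuousOn (fun η : E => (1 - a) * ‖s • η‖ ^ 2 + γ (s • η) ^ 2) U :=
    (by fun_prop : Continuous fun η : E => (1 - a) * ‖s • η‖ ^ 2).continuousOn.add
      ((hcγ.comp (by fun_prop : Continuous fun η : E => s • η).continuousOn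
        (mapsTo_preimage _ _)).pow 2)
  -- Both sides are continuous, so a strict reverse inequality would hold on a nonempty open set,
  -- which meets the dense set where `hae` applies.
  by_contra! hlt
  have hopen := (hc2.prodMk hc1).isOpen_inter_preimage hU isOpen_lt_prod
  obtain ⟨ξ, hξ, hξ'⟩ := (Measure.dense_of_ae hae).inter_open_nonempty _ hopen ⟨η, hη, hlt⟩
  exact absurd (hξ' hξ.1) (not_le.2 hξ.2)

end Rays

/-! ### Comparison of Hausdorff measures. -/

section

/-- If distances between images under `f` are controlled by distances between images under `g`,
then so are the Hausdorff measures of the images. -/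
theorem euclideanHausdorffMeasure_image_le_image {X Y Z : Type*} [MetricSpace Y] [MeasurableSpace Y]
    [BorelSpace Y] [MetricSpace Z] [MeasurableSpace Z] [BorelSpace Z] {A : Set X} {f : X → Y}
    {g : X → Z} {K : ℝ≥0} (h : ∀ x ∈ A, ∀ y ∈ A, dist (f x) (f y) ≤ K * dist (g x) (g y)) (m : ℕ) :
    μHE[m] (f '' A) ≤ (K : ℝ≥0∞) ^ m * μHE[m] (g '' A) := by
  rcases A.eq_empty_or_nonempty with rfl | ⟨x₀, hx₀⟩
  · simp
  have : Nonempty X := ⟨x₀⟩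
  set k : Z → X := Function.invFunOn g A
  have hk : ∀ z ∈ g '' A, k z ∈ A ∧ g (k z) = z := fun z hz => Function.invFunOn_pos hz
  have hlip : LipschitzOnWith K (f ∘ k) (g '' A) := by
    refine LipschitzOnWith.of_dist_le_mul fun z hz w hw => ?_
    have := h _ (hk z hz).1 _ (hk w hw).1
    rwa [(hk z hz).2, (hk w hw).2] at this
  -- `x` and `k (g x)` have the same image under `g`, hence by `h` also under `f`.
  have himg : f '' A ⊆ (f ∘ k) '' (g '' A) := by
    rintro _ ⟨x, hx, rfl⟩
    have hz : g x ∈ g '' A := mem_image_of_mem g hx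
    refine ⟨g x, hz, ?_⟩
    have := h _ (hk _ hz).1 _ hx
    rw [(hk _ hz).2, dist_self, mul_zero] at this
    exact dist_le_zero.1 this
  simp only [Measure.euclideanHausdorffMeasure_def, Measure.smul_apply, ENNReal.smul_def,
    smul_eq_mul]
  rw [mul_left_comm]
  gcongr
  refine (measure_mono himg).trans ?_
  simpa using hlip.hausdorffMeasure_image_le (d := (m : ℝ)) (by positivity)

/-! ### Graph points and the radial rescaling. -/

variable {m : ℕ}

theorem norm_pt_sq (η : Euc m) (y : ℝ) : ‖pt η y‖ ^ 2 = ‖η‖ ^ 2 + y ^ 2 := by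
  simp [EuclideanSpace.norm_sq_eq, pt, Fin.sum_univ_castSucc]

theorem pt_sub_pt (η ξ : Euc m) (y z : ℝ) : pt η y - pt ξ z = pt (η - ξ) (y - z) := by
  ext i
  refine Fin.lastCases ?_ (fun j => ?_) i <;> simp [pt]

theorem exists_eq_pt (z : Euc (m + 1)) : ∃ (η : Euc m) (y : ℝ), z = pt η y := by
  refine ⟨WithLp.toLp 2 fun i => z i.castSucc, z (Fin.last m), ?_⟩
  ext i
  refine Fin.lastCases ?_ (fun j => ?_) i <;> simp [pt]

theorem norm_le_norm_pt (η : Euc m) (y : ℝ) : ‖η‖ ≤ ‖pt η y‖ :=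
  le_of_sq_le_sq (by rw [norm_pt_sq]; nlinarith [sq_nonneg y]) (norm_nonneg _)

theorem abs_le_norm_pt (η : Euc m) (y : ℝ) : |y| ≤ ‖pt η y‖ :=
  le_of_sq_le_sq (by rw [norm_pt_sq, sq_abs]; nlinarith [sq_nonneg ‖η‖]) (norm_nonneg _)

theorem norm_pt_le (η : Euc m) (y : ℝ) : ‖pt η y‖ ≤ ‖η‖ + |y| := by
  refine le_of_sq_le_sq ?_ (by positivity)
  rw [norm_pt_sq]
  nlinarith [mul_nonneg (norm_nonneg η) (abs_nonneg y), sq_abs y]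

/-- The rescaling of `ℝ^m` along rays which replaces the norm of `η` by the norm of the point
`(η, γ(η))` of the graph. -/
noncomputable def radialRescale (γ : Euc m → ℝ) (η : Euc m) : Euc m := (‖pt η (γ η)‖ / ‖η‖) • η

variable {γ : Euc m → ℝ} {r a : ℝ} {L : ℝ≥0}

theorem norm_radialRescale (h0 : γ 0 = 0) (η : Euc m) :
    ‖radialRescale γ η‖ = ‖pt η (γ η)‖ := by
  rcases eq_or_ne η 0 with rfl | hη
  · have := norm_pt_sq (0 : Euc m) 0
    simp at this
    simp [radialRescale, h0, this]
  · have : ‖η‖ ≠ 0 := norm_ne_zero_iff.2 hη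
    rw [radialRescale, norm_smul, norm_div, norm_norm, norm_norm, div_mul_cancel₀ _ this]

theorem dist_graph_le (hL : LipschitzOnWith L γ (ball 0 r)) {η ξ : Euc m} (hη : η ∈ ball 0 r)
    (hξ : ξ ∈ ball 0 r) : ‖pt η (γ η) - pt ξ (γ ξ)‖ ≤ (1 + L) * ‖η - ξ‖ := by
  rw [pt_sub_pt]
  have := hL.dist_le_mul η hη ξ hξ
  rw [Real.dist_eq, dist_eq_norm] at this
  linarith [norm_pt_le (η - ξ) (γ η - γ ξ)]

theorem norm_graph_le (hL : LipschitzOnWith L γ (ball 0 r)) (h0 : γ 0 = 0) {η : Euc m}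
    (hη : η ∈ ball 0 r) : ‖pt η (γ η)‖ ≤ (1 + L) * ‖η‖ := by
  have hz : (0 : Euc m) ∈ ball 0 r := by
    rw [mem_ball_zero_iff] at *; simpa using (norm_nonneg η).trans_lt hη
  have hp : pt (0 : Euc m) (γ 0) = 0 := by
    rw [h0, ← norm_eq_zero, ← sq_eq_zero_iff, norm_pt_sq]; simp
  simpa [hp] using dist_graph_le hL hη hz

/-- Along rays, the norm of the points of the graph grows at least linearly. -/
theorem mul_sub_le_norm_graph_sub (hL : LipschitzOnWith L γ (ball 0 r)) (h0 : γ 0 = 0) (ha : 0 < a)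
    (hmono : ∀ s : ℝ, 1 ≤ s → ∀ η : Euc m, s • η ∈ ball (0 : Euc m) r →
      (1 - a) * ‖η‖ ^ 2 + γ η ^ 2 ≤ (1 - a) * ‖s • η‖ ^ 2 + γ (s • η) ^ 2)
    {e : Euc m} (he : ‖e‖ = 1) {t₁ t₂ : ℝ} (h1 : 0 < t₁) (h12 : t₁ ≤ t₂) (h2 : t₂ < r) :
    a * (t₂ - t₁) ≤
      (1 + L) * (‖pt (t₂ • e) (γ (t₂ • e))‖ - ‖pt (t₁ • e) (γ (t₁ • e))‖) := by
  have n1 : ‖t₁ • e‖ = t₁ := by rw [norm_smul, he, mul_one, Real.norm_of_nonneg h1.le]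
  have n2 : ‖t₂ • e‖ = t₂ := by
    rw [norm_smul, he, mul_one, Real.norm_of_nonneg (h1.le.trans h12)]
  have hs : (t₂ / t₁) • t₁ • e = t₂ • e := by rw [smul_smul, div_mul_cancel₀ _ h1.ne']
  have hm := hmono (t₂ / t₁) ((one_le_div h1).2 h12) (t₁ • e)
    (by rw [hs, mem_ball_zero_iff, n2]; exact h2)
  rw [hs, n1, n2] at hm
  have q1 := norm_pt_sq (t₁ • e) (γ (t₁ • e))
  have q2 := norm_pt_sq (t₂ • e) (γ (t₂ • e))
  have l1 := norm_le_norm_pt (t₁ • e) (γ (t₁ • e))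
  have u1 := norm_graph_le hL h0 (η := t₁ • e) (by rw [mem_ball_zero_iff, n1]; linarith)
  have u2 := norm_graph_le hL h0 (η := t₂ • e) (by rw [mem_ball_zero_iff, n2]; linarith)
  rw [n1] at q1 l1 u1
  have l2 := norm_le_norm_pt (t₂ • e) (γ (t₂ • e))
  rw [n2] at q2 l2 u2
  generalize ‖pt (t₁ • e) (γ (t₁ • e))‖ = x at *
  generalize ‖pt (t₂ • e) (γ (t₂ • e))‖ = y at *
  -- Since `x² = t₁² + γ²` and likewise for `y`, monotonicity reads `a(t₂² - t₁²) ≤ y² - x²`.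
  have hsq : a * (t₂ - t₁) * (t₂ + t₁) ≤ (y - x) * (y + x) := by nlinarith
  have hL0 : (0 : ℝ) ≤ L := L.2
  have hyx : 0 ≤ y - x := by
    by_contra! hneg
    have : (y - x) * (y + x) < 0 := mul_neg_of_neg_of_pos hneg (by linarith)
    have : 0 ≤ a * (t₂ - t₁) * (t₂ + t₁) :=
      mul_nonneg (mul_nonneg ha.le (by linarith)) (by linarith)
    linarith
  have hle : (y - x) * (y + x) ≤ (y - x) * ((1 + L) * (t₂ + t₁)) :=
    mul_le_mul_of_nonneg_left (by linarith) hyx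
  refine le_of_mul_le_mul_right (a := t₂ + t₁) ?_ (by linarith)
  linarith

/-- Split `η - ξ` into a radial part `(t - t') • e` and an angular part `t' • (e - e')`. The
rescaling keeps directions and does not decrease norms, which bounds the angular part by `2 * D`.
For the radial part, `η` is compared with `t' • e`, the point of its own ray at the radius of `ξ`.
-/
theorem norm_sub_le_radialRescale (hL : LipschitzOnWith L γ (ball 0 r)) (h0 : γ 0 = 0) (ha : 0 < a)
    (hmono : ∀ s : ℝ, 1 ≤ s → ∀ η : Euc m, s • η ∈ ball (0 : Euc m) r →
      (1 - a) * ‖η‖ ^ 2 + γ η ^ 2 ≤ (1 - a) * ‖s • η‖ ^ 2 + γ (s • η) ^ 2)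
    {η ξ : Euc m} (hη : η ∈ ball 0 r) (hξ : ξ ∈ ball 0 r) :
    ‖η - ξ‖ ≤ ((1 + L) * (3 + 2 * L) / a + 2) * ‖radialRescale γ η - radialRescale γ ξ‖ := by
  have hL0 : (0 : ℝ) ≤ L := L.2
  have hK : 1 ≤ (1 + L) * (3 + 2 * L) / a + 2 := by
    have : 0 ≤ (1 + L) * (3 + 2 * L) / a := by positivity
    linarith
  have hΦ0 : radialRescale γ 0 = 0 := by simp [radialRescale]
  rcases eq_or_ne η 0 with rfl | hη0
  · rw [hΦ0, zero_sub, zero_sub, norm_neg, norm_neg, norm_radialRescale h0]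
    nlinarith [norm_le_norm_pt ξ (γ ξ), norm_nonneg ξ]
  rcases eq_or_ne ξ 0 with rfl | hξ0
  · rw [hΦ0, sub_zero, sub_zero, norm_radialRescale h0]
    nlinarith [norm_le_norm_pt η (γ η), norm_nonneg η]
  set D := ‖radialRescale γ η - radialRescale γ ξ‖ with hD
  set t := ‖η‖ with ht
  set t' := ‖ξ‖ with ht'
  have tpos : 0 < t := norm_pos_iff.2 hη0
  have tpos' : 0 < t' := norm_pos_iff.2 hξ0
  set e := t⁻¹ • η with he
  set e' := t'⁻¹ • ξ with he'
  have ne : ‖e‖ = 1 := by rw [he, norm_smul, norm_inv, norm_norm]; exact inv_mul_cancel₀ tpos.ne'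
  have te : t • e = η := by rw [he, smul_inv_smul₀ tpos.ne']
  have te' : t' • e' = ξ := by rw [he', smul_inv_smul₀ tpos'.ne']
  set s := ‖pt η (γ η)‖ with hs
  set s' := ‖pt ξ (γ ξ)‖ with hs'
  have hη' : t < r := mem_ball_zero_iff.1 hη
  have hξ' : t' < r := mem_ball_zero_iff.1 hξ
  have hss : |s - s'| ≤ D := by
    rw [hs, hs', ← norm_radialRescale h0 η, ← norm_radialRescale h0 ξ]
    exact abs_norm_sub_norm_le _ _
  have hang : t' * ‖e - e'‖ ≤ 2 * D := by
    have h1 : s' • (e - e') = (radialRescale γ η - radialRescale γ ξ) - (s - s') • e := by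
      have h2 : radialRescale γ η = s • e := by
        rw [radialRescale, he, smul_smul, div_eq_mul_inv]
      have h3 : radialRescale γ ξ = s' • e' := by
        rw [radialRescale, he', smul_smul, div_eq_mul_inv]
      rw [h2, h3, smul_sub, sub_smul]; abel
    have h2 : s' * ‖e - e'‖ ≤ D + |s - s'| := by
      have := norm_sub_le (radialRescale γ η - radialRescale γ ξ) ((s - s') • e)
      rwa [← h1, norm_smul, norm_smul, ne, mul_one, Real.norm_eq_abs, Real.norm_eq_abs,
        abs_of_nonneg (norm_nonneg _ : 0 ≤ s')] at this
    have h3 : t' * ‖e - e'‖ ≤ s' * ‖e - e'‖ :=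
      mul_le_mul_of_nonneg_right (norm_le_norm_pt _ _) (norm_nonneg _)
    linarith
  have hmid : ‖t' • e - ξ‖ = t' * ‖e - e'‖ := by
    rw [← te', ← smul_sub, norm_smul, Real.norm_of_nonneg tpos'.le]
  have nte : ‖t' • e‖ = t' := by rw [norm_smul, ne, mul_one, Real.norm_of_nonneg tpos'.le]
  have hlip := dist_graph_le hL (η := t' • e) (by rw [mem_ball_zero_iff, nte]; exact hξ') hξ
  have hlip' := (abs_norm_sub_norm_le _ _).trans hlip
  rw [hmid] at hlip'
  set u := ‖pt (t' • e) (γ (t' • e))‖ with hu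
  have hrad : a * |t - t'| ≤ (1 + L) * |s - u| := by
    rcases le_total t' t with h | h
    · have := mul_sub_le_norm_graph_sub hL h0 ha hmono ne tpos' h hη'
      rw [te] at this
      rw [abs_of_nonneg (sub_nonneg.2 h)]
      exact this.trans (mul_le_mul_of_nonneg_left (le_abs_self _) (by positivity))
    · have := mul_sub_le_norm_graph_sub hL h0 ha hmono ne tpos h hξ'
      rw [te] at this
      rw [abs_sub_comm, abs_of_nonneg (sub_nonneg.2 h), abs_sub_comm s]
      exact this.trans (mul_le_mul_of_nonneg_left (le_abs_self _) (by positivity))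
  -- `D` from `hss`, plus `(1 + L) * 2D` from the Lipschitz bound applied to the angular part.
  have hsu : |s - u| ≤ (3 + 2 * L) * D := by
    have h1 : |s - u| ≤ |s - s'| + |s' - u| := abs_sub_le _ _ _
    rw [abs_sub_comm s' u] at h1
    have h2 : (1 + (L : ℝ)) * (t' * ‖e - e'‖) ≤ (1 + L) * (2 * D) :=
      mul_le_mul_of_nonneg_left hang (by positivity)
    linarith
  have htt : |t - t'| ≤ (1 + L) * (3 + 2 * L) / a * D := by
    rw [div_mul_eq_mul_div, le_div_iff₀ ha, mul_comm, mul_assoc]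
    exact hrad.trans (mul_le_mul_of_nonneg_left hsu (by positivity))
  have htri : ‖η - ξ‖ ≤ |t - t'| + t' * ‖e - e'‖ := by
    have h1 : η - ξ = (t - t') • e + (t' • e - ξ) := by rw [sub_smul, te]; abel
    rw [h1, ← hmid]
    refine (norm_add_le _ _).trans ?_
    rw [norm_smul, ne, mul_one, Real.norm_eq_abs]
  linarith

end

/-! ### Shells in a coordinate cylinder. -/

variable {m : ℕ} {S : Set (Euc (m + 1))} {x : Euc (m + 1)}
  {R : Euc (m + 1) ≃ₗᵢ[ℝ] Euc (m + 1)} {γ : Euc m → ℝ} {r δ a : ℝ} {L : ℝ≥0}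

/-- Near the centre of a coordinate cylinder, the points of `S` are points of the graph. -/
theorem IsCoordCylinder.exists_eq_pt (h : IsCoordCylinder S x R r δ γ) {y : Euc (m + 1)}
    (hy : y ∈ S) (hd : dist y x < min r δ) :
    ∃ η ∈ ball (0 : Euc m) r, y = x + R.symm (pt η (γ η)) ∧ dist y x = ‖pt η (γ η)‖ := by
  obtain ⟨η, t, hηt⟩ := LipschitzGraph.exists_eq_pt (R (y - x))
  have hn : ‖pt η t‖ = dist y x := by rw [← hηt, R.norm_map, dist_eq_norm]
  have hη : η ∈ ball (0 : Euc m) r := by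
    rw [mem_ball_zero_iff]
    exact (norm_le_norm_pt η t).trans_lt (hn ▸ hd.trans_le (min_le_left _ _))
  have ht : t ∈ Ioo (-δ) δ :=
    _root_.abs_lt.1 ((abs_le_norm_pt η t).trans_lt (hn ▸ hd.trans_le (min_le_right _ _)))
  have hmem : R (y - x) ∈ graphOver r γ := by
    rw [← h.inter_eq]
    exact ⟨mem_image_of_mem (fun x' => R (x' - x)) hy, η, hη, t, ht, hηt⟩
  obtain ⟨ξ, hξ, hR⟩ := hmem
  refine ⟨ξ, hξ, ?_, ?_⟩
  · rw [← hR]; simp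
  · rw [← hR, R.norm_map, dist_eq_norm]

theorem lipschitzOnWith_of_lipNorm_le (h : lipNorm r γ ≤ L) :
    LipschitzOnWith L γ (ball 0 r) := by
  refine LipschitzOnWith.of_dist_le_mul fun η hη ξ hξ => ?_
  rcases eq_or_ne η ξ with rfl | hne
  · simp
  have hpos : 0 < ‖η - ξ‖ := norm_pos_iff.2 (sub_ne_zero.2 hne)
  have h1 : ENNReal.ofReal (|γ η - γ ξ| / ‖η - ξ‖) ≤ L := by
    refine le_trans ?_ (le_add_self.trans h)
    exact le_iSup₂_of_le η hη (le_iSup₂_of_le ξ hξ (le_iSup_of_le hne le_rfl))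
  rw [← ENNReal.ofReal_coe_nnreal, ENNReal.ofReal_le_ofReal_iff L.coe_nonneg, div_le_iff₀ hpos] at h1
  rwa [Real.dist_eq, dist_eq_norm]

theorem ae_le_inner_of_le_radialEssInf (h : (a : EReal) ≤ radialEssInf r γ) :
    ∀ᵐ η : Euc m, η ∈ ball (0 : Euc m) r →
      a * ‖η‖ ^ 2 ≤ inner ℝ (η + γ η • ∇ γ η) η := by
  have h1 := ae_essInf_le (μ := volume.restrict (ball (0 : Euc m) r \ {0}))
    (f := fun η => (radialQuotient γ η : EReal))
  rw [ae_restrict_iff' (measurableSet_ball.diff (measurableSet_singleton _))] at h1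
  filter_upwards [h1] with η hη hb
  rcases eq_or_ne η 0 with rfl | h0
  · simp
  · have h2 : a ≤ radialQuotient γ η := EReal.coe_le_coe_iff.1 (h.trans (hη ⟨hb, h0⟩))
    rwa [radialQuotient, le_div_iff₀ (by positivity)] at h2

/-- The area of the part of a graph in a spherical shell is controlled by the volume of the shell
with the same radii in the parameter space. -/
theorem IsCoordCylinder.measure_shell_le (h : IsCoordCylinder S x R r δ γ)
    (hL : lipNorm r γ ≤ L) (ha : 0 < a) (hinf : (a : EReal) ≤ radialEssInf r γ) {K : ℝ≥0}
    (hK : (1 + L) * ((1 + L) * (3 + 2 * L) / a + 2) = (K : ℝ)) {r₁ r₂ : ℝ}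
    (hr₂ : r₂ ≤ min r δ) :
    μHE[m] ((ball x r₂ \ ball x r₁) ∩ S) ≤
      (K : ℝ≥0∞) ^ m * volume (ball (0 : Euc m) r₂ \ ball (0 : Euc m) r₁) := by
  have hLip := lipschitzOnWith_of_lipNorm_le hL
  have hmono := fun (s : ℝ) (hs : 1 ≤ s) =>
    le_radial_of_ae hLip (ae_le_inner_of_le_radialEssInf hinf) hs
  set A : Set (Euc m) := {η | η ∈ ball (0 : Euc m) r ∧ r₁ ≤ ‖pt η (γ η)‖ ∧ ‖pt η (γ η)‖ < r₂}
  set F : Euc m → Euc (m + 1) := fun η => x + R.symm (pt η (γ η))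
  have hsub : (ball x r₂ \ ball x r₁) ∩ S ⊆ F '' A := by
    rintro y ⟨⟨hy₂, hy₁⟩, hy⟩
    rw [mem_ball] at hy₂ hy₁
    obtain ⟨η, hη, hyη, hd⟩ := h.exists_eq_pt hy (hy₂.trans_le hr₂)
    exact ⟨η, ⟨hη, hd ▸ not_lt.1 hy₁, hd ▸ hy₂⟩, hyη.symm⟩
  have hdist : ∀ η ∈ A, ∀ ξ ∈ A,
      dist (F η) (F ξ) ≤ K * dist (radialRescale γ η) (radialRescale γ ξ) := by
    intro η hη ξ hξ
    have h1 : dist (F η) (F ξ) = ‖pt η (γ η) - pt ξ (γ ξ)‖ := by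
      simp only [F]
      rw [dist_eq_norm, add_sub_add_left_eq_sub, ← map_sub, R.symm.norm_map]
    rw [h1, dist_eq_norm, ← hK, mul_assoc]
    exact (dist_graph_le hLip hη.1 hξ.1).trans (mul_le_mul_of_nonneg_left
      (norm_sub_le_radialRescale hLip h.map_zero ha hmono hη.1 hξ.1) (by positivity))
  have himg : radialRescale γ '' A ⊆ ball (0 : Euc m) r₂ \ ball (0 : Euc m) r₁ := by
    rintro _ ⟨η, hη, rfl⟩
    rw [mem_sdiff, mem_ball_zero_iff, mem_ball_zero_iff, norm_radialRescale h.map_zero, not_lt]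
    exact ⟨hη.2.2, hη.2.1⟩
  calc μHE[m] ((ball x r₂ \ ball x r₁) ∩ S) ≤ μHE[m] (F '' A) := measure_mono hsub
    _ ≤ (K : ℝ≥0∞) ^ m * μHE[m] (radialRescale γ '' A) :=
      euclideanHausdorffMeasure_image_le_image hdist m
    _ ≤ (K : ℝ≥0∞) ^ m * μHE[m] (ball (0 : Euc m) r₂ \ ball (0 : Euc m) r₁) := by
      gcongr
    _ = _ := by
      rw [EuclideanSpace.euclideanHausdorffMeasure_eq_volume]

theorem volume_ball_diff_ball (hm : 1 ≤ m) {r₁ r₂ : ℝ} (h1 : 0 ≤ r₁) (h12 : r₁ ≤ r₂) :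
    volume (ball (0 : Euc m) r₂ \ ball (0 : Euc m) r₁) =
      ENNReal.ofReal (r₂ ^ m - r₁ ^ m) * volume (ball (0 : Euc m) 1) := by
  -- Positive dimension matters when `r₁ = 0`: the inner ball is empty, and `0 ^ m = 0` requires `m
  -- ≠ 0`.
  have : Nonempty (Fin m) := ⟨⟨0, hm⟩⟩
  rw [measure_sdiff (ball_subset_ball h12) measurableSet_ball.nullMeasurableSet
      measure_ball_lt_top.ne, Measure.addHaar_ball _ _ h1, Measure.addHaar_ball _ _ (h1.trans h12),
    ← ENNReal.sub_mul fun _ _ => measure_ball_lt_top.ne, finrank_euclideanSpace_fin,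
    ENNReal.ofReal_sub _ (by positivity)]

end LipschitzGraph

/-! ### Uniform constants and conclusion. -/

theorem propositionA5 (m : ℕ) (hm : 1 ≤ m) (S : Set (LipschitzGraph.Euc (m + 1)))
    (hS : IsCompact S) (hSL : LipschitzGraph.IsLocalLipschitzGraph S)
    (hcyl : ∃ r δ : ℝ, 0 < r ∧ 0 < δ ∧
      ∃ (R : LipschitzGraph.Euc (m + 1) →
          (LipschitzGraph.Euc (m + 1) ≃ₗᵢ[ℝ] LipschitzGraph.Euc (m + 1)))
        (γ : LipschitzGraph.Euc (m + 1) → LipschitzGraph.Euc m → ℝ),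
        (∀ x ∈ S, LipschitzGraph.IsCoordCylinder S x (R x) r δ (γ x)) ∧
        (⨆ x ∈ S, LipschitzGraph.lipNorm r (γ x)) < ⊤ ∧
        0 < ⨅ x ∈ S, LipschitzGraph.radialEssInf r (γ x)) :
    LipschitzGraph.IsStronglyUpperAhlforsRegular S S (LipschitzGraph.surfaceMeasure S) (m : ℝ) := by
  obtain ⟨r, δ, hr, hδ, R, γ, hc, hsup, hinf⟩ := hcyl
  -- The infimum is an extended real and may be `⊤`; a smaller positive real serves for all `x`.
  obtain ⟨a, ha, ha'⟩ := EReal.lt_iff_exists_real_btwn.1 hinf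
  replace ha : 0 < a := EReal.coe_pos.1 ha
  obtain ⟨L, hL⟩ := WithTop.ne_top_iff_exists.1 hsup.ne
  change (L : ENNReal) = _ at hL
  -- Lipschitz constant `1 + L` of the graph map times that of the inverse rescaling.
  obtain ⟨K, hK⟩ : ∃ K : NNReal, (1 + L) * ((1 + L) * (3 + 2 * L) / a + 2) = (K : ℝ) :=
    ⟨⟨_, by positivity⟩, rfl⟩
  set ρ := min r δ with hρ
  have hρ0 : 0 < ρ := lt_min hr hδ
  set c : ℝ := (K : ℝ) ^ m * (volume (ball (0 : LipschitzGraph.Euc m) 1)).toReal with hcdef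
  have hVpos : 0 < (volume (ball (0 : LipschitzGraph.Euc m) 1)).toReal :=
    ENNReal.toReal_pos (measure_ball_pos volume _ one_pos).ne' measure_ball_lt_top.ne
  have hKpos : (0 : ℝ) < K := by
    rw [← hK]
    positivity
  have hcpos : 0 < c := mul_pos (pow_pos hKpos m) hVpos
  have hshell : ∀ x ∈ S, ∀ r₁ r₂ : ℝ, 0 ≤ r₁ → r₁ < r₂ → r₂ ≤ ρ →
      LipschitzGraph.surfaceMeasure S ((ball x r₂ \ ball x r₁) ∩ S) ≤
        ENNReal.ofReal (c * (r₂ ^ (m : ℝ) - r₁ ^ (m : ℝ))) := by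
    intro x hx r₁ r₂ h1 h12 h2
    have hLx : LipschitzGraph.lipNorm r (γ x) ≤ L := by
      rw [hL]; exact le_iSup₂_of_le x hx le_rfl
    have hax : (a : EReal) ≤ LipschitzGraph.radialEssInf r (γ x) :=
      ha'.le.trans (iInf₂_le x hx)
    have := (hc x hx).measure_shell_le hLx ha hax hK (r₁ := r₁) h2
    rw [LipschitzGraph.volume_ball_diff_ball hm h1 h12.le] at this
    refine (Measure.restrict_apply_le _ _).trans (this.trans_eq ?_)
    rw [Real.rpow_natCast, Real.rpow_natCast, hcdef, mul_assoc, mul_comm (ENNReal.toReal _),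
      ENNReal.ofReal_mul (by positivity), ENNReal.ofReal_mul
        (sub_nonneg.2 (pow_le_pow_left₀ h1 h12.le m)),
      ENNReal.ofReal_toReal measure_ball_lt_top.ne, ENNReal.ofReal_pow K.coe_nonneg,
      ENNReal.ofReal_coe_nnreal]
  refine ⟨fun x _ s _ => ?_, ENNReal.ofReal ρ, ENNReal.ofReal_pos.2 hρ0, c, hcpos,
    fun x hx r₁ r₂ h1 h12 h2 => hshell x hx r₁ r₂ h1 h12 ?_⟩
  · refine (measure_mono inter_subset_right).trans_lt ?_
    -- By compactness local finiteness suffices, and the shell bound with `r₁ = 0` gives it.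
    refine hS.measure_lt_top_of_nhdsWithin fun x hx => ?_
    refine ⟨ball x ρ ∩ S, Filter.inter_mem (mem_nhdsWithin_of_mem_nhds (ball_mem_nhds x hρ0))
      self_mem_nhdsWithin, ?_⟩
    have := hshell x hx 0 ρ le_rfl hρ0 le_rfl
    rw [ball_zero, sdiff_empty] at this
    exact this.trans_lt ENNReal.ofReal_lt_top
  · exact ((ENNReal.ofReal_lt_ofReal_iff hρ0).1 h2).le
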